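/- Let $r:\mathbb R^m\to\mathbb R\cup\{+\infty\}$ be a lower semicontinuous convex function, let $\bar x\in\operatorname{dom} r=\{x: r(x)<\infty\}$, let $\bar u\in\partial r(\bar x)$ (the limiting subdifferential, which for convex $r$ is the subdifferential of convex analysis), and let $\sigma>0$. Let $r^*(x)=\sup_{u\in\operatorname{dom} r}\{\langle x,u\rangle-r(u)\}$ be the Fenchel conjugate of $r$, and for $\tau>0$ and a proper lower semicontinuous convex function $f$ let $$\operatorname{Prox}_{\tau f}(x)=\operatorname*{arg\,min}_{u\in\mathbb R^m}\Big\{f(u)+\tfrac1{2\tau}\|u-x\|^2\Big\}.$$ For a set $C\subset\mathbb R^N$ and $x\in C$, let $\widehat N_C(x)$ be the set of all $y$ with $\limsup_{x'\to x,\ x'\in C\setminus\{x\}}\langle y,x'-x\rangle/\|x'-x\|\le 0$, and let $N_C(x)$ be the set of all limits of sequences $y^k\in\widehat N_C(x^k)$ with $x^k\in C$, $x^k\to x$. The limiting coderivative of a single-valued mapping $S:\mathbb R^m\to\mathbb R^m$ at $x$ is given by $$v\in D^*S(x)(d)\iff (v,-d)\in N_{\operatorname{gph}S}(x,S(x)),$$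 and, for $S$ Lipschitz continuous, the Clarke generalized Jacobian $JS(x)$ is the convex hull of the set of all limits of Jacobian matrices $S'(x^k)$ along sequences $x^k\to x$ of points at which $S$ is differentiable. Then $\operatorname{Prox}_r$ and $\operatorname{Prox}_{\sigma r^*}$ are single-valued on all of $\mathbb R^m$, and for every $d\in\mathbb R^m$ and every $v\in D^*\operatorname{Prox}_{\sigma r^*}(\bar u+\sigma\bar x)(d)$ there is a matrix $U\in J\operatorname{Prox}_r(\bar x+\bar u)$ such that $I+(\sigma-1)U$ is invertible and $$v=(I+(\sigma-1)U)^{-1}(I-U)d.$$ -/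

import Mathlib

open Filter Topology

noncomputable section

namespace ProxCoderivative

/-! ### Extended-real-valued functions -/

section Functions

variable {E : Type*} [NormedAddCommGroup E] [InnerProductSpace ℝ E]

/-- The effective domain of an extended-real-valued function. -/
def effDom (r : E → EReal) : Set E := {x | r x < ⊤}

/-- The epigraph of an extended-real-valued function. -/
def epigraph (r : E → EReal) : Set (E × ℝ) := {p | r p.1 ≤ (p.2 : EReal)}

/-- The Fenchel conjugate `r*(x) = sup {⟨x, u⟩ - r(u) | u ∈ dom r}`. -/
def conjugate (r : E → EReal) (x : E) : EReal :=
  ⨆ u ∈ effDom r, (((inner ℝ x u : ℝ) : EReal) - r u)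

/-- The proximal mapping of `σ r` as a set-valued mapping:
`Prox_{σ r}(x) = argmin_u {r(u) + ‖u - x‖² / (2σ)}`. -/
def proxSet (σ : ℝ) (r : E → EReal) (x : E) : Set E :=
  {u | u ∈ effDom r ∧ ∀ w : E,
    r u + ((1 / (2 * σ) * ‖u - x‖ ^ 2 : ℝ) : EReal) ≤
      r w + ((1 / (2 * σ) * ‖w - x‖ ^ 2 : ℝ) : EReal)}

/-- The proximal mapping of `σ r` as a single-valued mapping: the element of `proxSet σ r x`
(there is exactly one when `r` is proper, lower semicontinuous and convex, and `0 < σ`). -/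
def prox (σ : ℝ) (r : E → EReal) (x : E) : E :=
  Classical.epsilon fun u => u ∈ proxSet σ r x

/-- The regular (Fréchet) subdifferential: those `y` with
`r(x') ≥ r(x) + ⟨y, x' - x⟩ + o(‖x' - x‖)`, for `x ∈ dom r`. -/
def regularSubdifferential (r : E → EReal) (x : E) : Set E :=
  {y | x ∈ effDom r ∧ ∀ ε : ℝ, 0 < ε → ∀ᶠ x' in 𝓝 x,
    r x + ((inner ℝ y (x' - x) - ε * ‖x' - x‖ : ℝ) : EReal) ≤ r x'}

/-- The limiting (Mordukhovich) subdifferential, for `x ∈ dom r`. -/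
def limitingSubdifferential (r : E → EReal) (x : E) : Set E :=
  {y | x ∈ effDom r ∧ ∃ (xs ys : ℕ → E),
    Tendsto xs atTop (𝓝 x) ∧ Tendsto (fun k => r (xs k)) atTop (𝓝 (r x)) ∧
    (∀ k, ys k ∈ regularSubdifferential r (xs k)) ∧ Tendsto ys atTop (𝓝 y)}

end Functions

/-! ### Normal cones and coderivatives -/

section Cones

variable {H : Type*} [NormedAddCommGroup H] [InnerProductSpace ℝ H]

/-- The regular (Fréchet) normal cone to `C` at `x ∈ C`: those `y` for which the upper limit of
`⟨y, x' - x⟩ / ‖x' - x‖`, as `x' → x` within `C \ {x}`, is at most `0`. -/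
def regularNormalCone (C : Set H) (x : H) : Set H :=
  {y | x ∈ C ∧ ∀ ε : ℝ, 0 < ε → ∀ᶠ x' in 𝓝[C] x, inner ℝ y (x' - x) ≤ ε * ‖x' - x‖}

/-- The limiting (Mordukhovich) normal cone to `C` at `x ∈ C`. -/
def limitingNormalCone (C : Set H) (x : H) : Set H :=
  {y | x ∈ C ∧ ∃ (xs ys : ℕ → H),
    (∀ k, xs k ∈ C) ∧ Tendsto xs atTop (𝓝 x) ∧
    (∀ k, ys k ∈ regularNormalCone C (xs k)) ∧ Tendsto ys atTop (𝓝 y)}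

end Cones

section Derivatives

variable {E F : Type*} [NormedAddCommGroup E] [InnerProductSpace ℝ E]
  [NormedAddCommGroup F] [InnerProductSpace ℝ F]

/-- The graph of a set-valued mapping, in the Euclidean product of the two spaces. -/
def gph (S : E → Set F) : Set (WithLp 2 (E × F)) := {p | p.snd ∈ S p.fst}

/-- The limiting coderivative `D*S(x, u)(w)` of a set-valued mapping `S` at `x` for `u ∈ S x`. -/
def limitingCoderivative (S : E → Set F) (x : E) (u : F) (w : F) : Set E :=
  {z | WithLp.toLp 2 (z, -w) ∈ limitingNormalCone (gph S) (WithLp.toLp 2 (x, u))}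

/-- The limiting Jacobian of `S` at `x`: all limits of derivatives of `S` at points of
differentiability that converge to `x`. -/
def limitingJacobian (S : E → F) (x : E) : Set (E →L[ℝ] F) :=
  {V | ∃ xs : ℕ → E, (∀ k, DifferentiableAt ℝ S (xs k)) ∧ Tendsto xs atTop (𝓝 x) ∧
    Tendsto (fun k => fderiv ℝ S (xs k)) atTop (𝓝 V)}

/-- The Clarke generalized Jacobian: the convex hull of the limiting Jacobian. -/
def clarkeJacobian (S : E → F) (x : E) : Set (E →L[ℝ] F) :=
  convexHull ℝ (limitingJacobian S x)

end Derivatives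

end ProxCoderivative

end

/-!
`Prox_r = (I + ∂r)⁻¹` and `Prox_{σ r*} = (I + σ ∂r*)⁻¹` have graphs that are images of the graph of
`∂r` under invertible linear maps, so the linear map `T (z, p) = (z + (σ - 1) p, z - p)` carries
`gph Prox_r` onto `gph Prox_{σ r*}`. Normal cones are transported by the adjoint of `T`: if
`v ∈ D*Prox_{σ r*}(ū + σ x̄)(d)`, then `v - d ∈ D*Prox_r(x̄ + ū)(-((σ - 1) v + d))`.

For a Lipschitz mapping `S`, the coderivative is controlled by the Clarke Jacobian: each element of
`D*S(x)(e)` has the form `U* e` with `U ∈ JS(x)`. Otherwise a hyperplane separates it from the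
compact convex set of all such `U* e`, that is, for some direction `h` every derivative of `S` near
`x` has `⟪e, S'(z) h⟫` below a constant that the normal vector exceeds; integrating the derivative
along almost every line parallel to `h` contradicts the normality.

Finally `Prox_r` is the gradient of the convex function `z ↦ ½ ‖z‖² - min (r + ½ ‖· - z‖²)`, and it
is firmly nonexpansive, so every `U ∈ J Prox_r` is self-adjoint with `0 ≤ U ≤ I`. Hence
`I + (σ - 1) U` is positive definite, and `v - d = U (-((σ - 1) v + d))` can be solved for `v`.
-/

namespace ProxCoderivative

open scoped RealInnerProductSpace

section Preliminaries

theorem le_of_forall_pos_le_add_mul {a b c : ℝ} (h : ∀ ε > 0, a ≤ b + ε * c) : a ≤ b := by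
  have hlim : Tendsto (fun ε : ℝ => b + ε * c) (𝓝[>] 0) (𝓝 b) := by
    have hcont : Continuous fun ε : ℝ => b + ε * c := by fun_prop
    simpa only [zero_mul, add_zero] using (hcont.tendsto 0).mono_left nhdsWithin_le_nhds
  exact ge_of_tendsto hlim (eventually_mem_nhdsWithin.mono h)

theorem tendsto_add_smul_nhdsGT_zero {E : Type*} [NormedAddCommGroup E] [NormedSpace ℝ E]
    (x h : E) : Tendsto (fun t : ℝ => x + t • h) (𝓝[>] 0) (𝓝 x) := by
  have hcont : Continuous fun t : ℝ => x + t • h := by fun_prop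
  simpa only [zero_smul, add_zero] using (hcont.tendsto 0).mono_left nhdsWithin_le_nhds

theorem exists_eq_coe_of_mem_effDom {X : Type*} {f : X → EReal} {x : X} (hbot : f x ≠ ⊥)
    (hx : x ∈ effDom f) : ∃ a : ℝ, f x = a :=
  ⟨(f x).toReal, (EReal.coe_toReal hx.ne hbot).symm⟩

end Preliminaries

section Subgradient

variable {E : Type*} [NormedAddCommGroup E] [InnerProductSpace ℝ E] {f : E → EReal} {x y u v : E}

/-- `u` is a subgradient of `f` at `x` in the sense of convex analysis. The value `f x` is required
to be finite, so that a function with a subgradient is proper. -/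
def IsSubgradient (f : E → EReal) (x u : E) : Prop :=
  ∃ a : ℝ, f x = a ∧ ∀ z, ((a + ⟪u, z - x⟫ : ℝ) : EReal) ≤ f z

theorem IsSubgradient.ne_bot (h : IsSubgradient f x u) (z : E) : f z ≠ ⊥ := by
  obtain ⟨a, -, hsub⟩ := h
  exact ne_bot_of_le_ne_bot (EReal.coe_ne_bot _) (hsub z)

theorem IsSubgradient.inner_sub_nonneg (hx : IsSubgradient f x u) (hy : IsSubgradient f y v) :
    0 ≤ ⟪u - v, x - y⟫ := by
  obtain ⟨a, ha, hsub_x⟩ := hx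
  obtain ⟨b, hb, hsub_y⟩ := hy
  have hxy : a + ⟪u, y - x⟫ ≤ b := EReal.coe_le_coe_iff.1 (hb ▸ hsub_x y)
  have hyx : b + ⟪v, x - y⟫ ≤ a := EReal.coe_le_coe_iff.1 (ha ▸ hsub_y x)
  rw [← neg_sub x y, inner_neg_right] at hxy
  rw [inner_sub_left]
  linarith

theorem IsSubgradient.of_mem_regularSubdifferential (hbot : f x ≠ ⊥)
    (hconv : Convex ℝ (epigraph f)) (hu : u ∈ regularSubdifferential f x) :
    IsSubgradient f x u := by
  obtain ⟨hx, hreg⟩ := hu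
  obtain ⟨a, ha⟩ := exists_eq_coe_of_mem_effDom hbot hx
  refine ⟨a, ha, fun z => EReal.le_of_forall_lt_iff_le.1 fun b hb => EReal.coe_le_coe_iff.2 ?_⟩
  refine le_of_forall_pos_le_add_mul (c := ‖z - x‖) fun ε hε => ?_
  obtain ⟨t, hlow, ht⟩ := (((tendsto_add_smul_nhdsGT_zero x (z - x)).eventually (hreg ε hε)).and
    (Ioc_mem_nhdsGT one_pos)).exists
  have hup : f (x + t • (z - x)) ≤ ((a + t * (b - a) : ℝ) : EReal) :=
    hconv.add_smul_sub_mem (x := (x, a)) (y := (z, b)) ha.le hb.le ⟨ht.1.le, ht.2⟩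
  have hle := hlow.trans hup
  rw [ha, ← EReal.coe_add, EReal.coe_le_coe_iff, add_sub_cancel_left, inner_smul_right,
    norm_smul, Real.norm_of_nonneg ht.1.le] at hle
  refine le_of_mul_le_mul_left ?_ ht.1
  linarith

theorem IsSubgradient.of_mem_limitingSubdifferential (hbot : ∀ x, f x ≠ ⊥)
    (hconv : Convex ℝ (epigraph f)) (hu : u ∈ limitingSubdifferential f x) :
    IsSubgradient f x u := by
  obtain ⟨hx, xs, us, hxs, hfxs, hus, hlim⟩ := hu
  obtain ⟨a, ha⟩ := exists_eq_coe_of_mem_effDom (hbot x) hx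
  choose as has hsub using fun k => IsSubgradient.of_mem_regularSubdifferential (hbot (xs k)) hconv
    (hus k)
  simp only [has, ha, EReal.tendsto_coe] at hfxs
  refine ⟨a, ha, fun z => ?_⟩
  have hlower : Tendsto (fun k => ((as k + ⟪us k, z - xs k⟫ : ℝ) : EReal)) atTop
      (𝓝 ((a + ⟪u, z - x⟫ : ℝ) : EReal)) :=
    EReal.tendsto_coe.2 (hfxs.add (hlim.inner (tendsto_const_nhds.sub hxs)))
  exact le_of_tendsto hlower (Eventually.of_forall fun k => hsub k z)

end Subgradient

section ProximalMapping

/-- The function `w ↦ f w + ‖w - x‖² / (2 σ)`, whose minimizers make up `proxSet σ f x`. -/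
noncomputable def proxObjective {E : Type*} [NormedAddCommGroup E] (σ : ℝ)
    (f : E → EReal) (x w : E) : EReal :=
  f w + ((1 / (2 * σ) * ‖w - x‖ ^ 2 : ℝ) : EReal)

theorem lowerSemicontinuous_proxObjective {E : Type*} [NormedAddCommGroup E] {f : E → EReal}
    (hlsc : LowerSemicontinuous f) (σ : ℝ) (x : E) :
    LowerSemicontinuous (proxObjective σ f x) := by
  have hquad : Continuous fun w => ((1 / (2 * σ) * ‖w - x‖ ^ 2 : ℝ) : EReal) :=
    continuous_coe_real_ereal.comp (by fun_prop)
  exact hlsc.add' hquad.lowerSemicontinuous fun _ =>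
    EReal.continuousAt_add (.inr (EReal.coe_ne_bot _)) (.inr (EReal.coe_ne_top _))

variable {E : Type*} [NormedAddCommGroup E] [InnerProductSpace ℝ E] {f : E → EReal}
  {σ : ℝ} {x p q u : E}

theorem mul_norm_sub_sq_eq (hσ : σ ≠ 0) (w p x : E) :
    1 / (2 * σ) * ‖w - x‖ ^ 2 =
      1 / (2 * σ) * ‖p - x‖ ^ 2 - ⟪σ⁻¹ • (x - p), w - p⟫ + 1 / (2 * σ) * ‖w - p‖ ^ 2 := by
  have hwx : w - x = (w - p) - (x - p) := by abel
  rw [hwx, norm_sub_sq_real, real_inner_comm, norm_sub_rev p x, real_inner_smul_left]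
  field_simp
  ring

theorem IsSubgradient.add_le_proxObjective (hσ : σ ≠ 0) {a : ℝ} (hp : f p = a)
    (h : IsSubgradient f p u) (x w : E) :
    ((a + 1 / (2 * σ) * ‖p - x‖ ^ 2 + ⟪u - σ⁻¹ • (x - p), w - p⟫
      + 1 / (2 * σ) * ‖w - p‖ ^ 2 : ℝ) : EReal) ≤ proxObjective σ f x w := by
  obtain ⟨b, hb, hsub⟩ := h
  obtain rfl : a = b := EReal.coe_injective (hp.symm.trans hb)
  have hle := add_le_add_left (hsub w) ((1 / (2 * σ) * ‖w - x‖ ^ 2 : ℝ) : EReal)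
  rw [← EReal.coe_add, mul_norm_sub_sq_eq hσ w p x] at hle
  rw [proxObjective, mul_norm_sub_sq_eq hσ w p x]
  refine le_of_eq_of_le (congrArg _ ?_) hle
  rw [inner_sub_left]
  ring

theorem IsSubgradient.mem_proxSet (hσ : 0 < σ) (h : IsSubgradient f p (σ⁻¹ • (x - p))) :
    p ∈ proxSet σ f x := by
  obtain ⟨a, ha, -⟩ := id h
  refine ⟨ha.trans_lt (EReal.coe_lt_top a), fun w =>
    le_trans ?_ (h.add_le_proxObjective hσ.ne' ha x w)⟩
  rw [ha, ← EReal.coe_add, EReal.coe_le_coe_iff, sub_self, inner_zero_left, add_zero]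
  exact le_add_of_nonneg_right (by positivity)

theorem mem_regularSubdifferential_of_mem_proxSet (hbot : f p ≠ ⊥) (hσ : 0 < σ)
    (h : p ∈ proxSet σ f x) : σ⁻¹ • (x - p) ∈ regularSubdifferential f p := by
  obtain ⟨hp, hmin⟩ := h
  obtain ⟨a, ha⟩ := exists_eq_coe_of_mem_effDom hbot hp
  refine ⟨hp, fun ε hε => ?_⟩
  filter_upwards [Metric.ball_mem_nhds p (show 0 < 2 * σ * ε by positivity)] with w hw
  rw [mem_ball_iff_norm] at hw
  refine EReal.le_of_forall_lt_iff_le.1 fun b hb => ?_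
  have hle := (hmin w).trans (add_le_add_left hb.le _)
  rw [ha, ← EReal.coe_add, ← EReal.coe_add, EReal.coe_le_coe_iff,
    mul_norm_sub_sq_eq hσ.ne' w p x] at hle
  have hquad : 1 / (2 * σ) * ‖w - p‖ ^ 2 ≤ ε * ‖w - p‖ := by
    rw [sq, ← mul_assoc]
    gcongr
    rw [one_div, inv_mul_le_iff₀ (by positivity)]
    exact hw.le
  rw [ha, ← EReal.coe_add, EReal.coe_le_coe_iff]
  linarith

theorem mem_proxSet_iff_isSubgradient (hbot : ∀ z, f z ≠ ⊥) (hconv : Convex ℝ (epigraph f))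
    (hσ : 0 < σ) : p ∈ proxSet σ f x ↔ IsSubgradient f p (σ⁻¹ • (x - p)) :=
  ⟨fun h => .of_mem_regularSubdifferential (hbot p) hconv
    (mem_regularSubdifferential_of_mem_proxSet (hbot p) hσ h), fun h => h.mem_proxSet hσ⟩

theorem mem_proxSet_one_iff_isSubgradient (hbot : ∀ z, f z ≠ ⊥) (hconv : Convex ℝ (epigraph f)) :
    p ∈ proxSet 1 f x ↔ IsSubgradient f p (x - p) := by
  rw [mem_proxSet_iff_isSubgradient hbot hconv one_pos, inv_one, one_smul]

theorem eq_of_mem_proxSet (hbot : ∀ z, f z ≠ ⊥) (hconv : Convex ℝ (epigraph f)) (hσ : 0 < σ)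
    (hp : p ∈ proxSet σ f x) (hq : q ∈ proxSet σ f x) : p = q := by
  rw [mem_proxSet_iff_isSubgradient hbot hconv hσ] at hp hq
  have hmono := hp.inner_sub_nonneg hq
  rw [← smul_sub, sub_sub_sub_cancel_left, ← neg_sub p q, smul_neg, inner_neg_left,
    real_inner_smul_left, neg_nonneg] at hmono
  rw [← sub_eq_zero, ← real_inner_self_nonpos]
  exact nonpos_of_mul_nonpos_right hmono (inv_pos.2 hσ)

theorem IsSubgradient.exists_radius_proxObjective_le (hσ : 0 < σ) (h : IsSubgradient f p u)
    (x : E) : ∃ R ≥ 0, ∀ w ∉ Metric.closedBall p R,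
      proxObjective σ f x p ≤ proxObjective σ f x w := by
  obtain ⟨a, ha, -⟩ := id h
  set v : E := u - σ⁻¹ • (x - p)
  refine ⟨2 * σ * ‖v‖, by positivity, fun w hw => le_trans ?_
    (h.add_le_proxObjective hσ.ne' ha x w)⟩
  rw [mem_closedBall_iff_norm, not_le] at hw
  have hlinear : -(‖v‖ * ‖w - p‖) ≤ ⟪v, w - p⟫ := neg_le_of_abs_le (abs_real_inner_le_norm _ _)
  have hquad : ‖v‖ * ‖w - p‖ ≤ 1 / (2 * σ) * ‖w - p‖ ^ 2 := by
    rw [sq, ← mul_assoc]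
    gcongr
    rw [one_div, le_inv_mul_iff₀ (by positivity)]
    exact hw.le
  rw [proxObjective, ha, ← EReal.coe_add, EReal.coe_le_coe_iff]
  linarith

section FiniteDimensional

variable [FiniteDimensional ℝ E]

theorem proxSet_nonempty (hlsc : LowerSemicontinuous f) (h : IsSubgradient f p u) (hσ : 0 < σ)
    (x : E) : (proxSet σ f x).Nonempty := by
  obtain ⟨R, hR, hfar⟩ := h.exists_radius_proxObjective_le hσ x
  have hpR : p ∈ Metric.closedBall p R := Metric.mem_closedBall_self hR
  obtain ⟨q, -, hq⟩ := ((lowerSemicontinuous_proxObjective hlsc σ x).lowerSemicontinuousOn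
    (Metric.closedBall p R)).exists_isMinOn ⟨p, hpR⟩ (isCompact_closedBall p R)
  have hmin : ∀ w, proxObjective σ f x q ≤ proxObjective σ f x w := fun w => by
    by_cases hw : w ∈ Metric.closedBall p R
    exacts [hq hw, (hq hpR).trans (hfar w hw)]
  refine ⟨q, ?_, hmin⟩
  obtain ⟨a, ha, -⟩ := h
  have hfinite : proxObjective σ f x q < ⊤ := (hmin p).trans_lt <| by
    rw [proxObjective, ha, ← EReal.coe_add]
    exact EReal.coe_lt_top _
  exact (EReal.add_ne_top_iff_ne_top_left (EReal.coe_ne_bot _) (EReal.coe_ne_top _)).1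
    hfinite.ne |>.lt_top

theorem existsUnique_mem_proxSet (hlsc : LowerSemicontinuous f) (hconv : Convex ℝ (epigraph f))
    (h : IsSubgradient f p u) (hσ : 0 < σ) (x : E) : ∃! q, q ∈ proxSet σ f x :=
  existsUnique_of_exists_of_unique (proxSet_nonempty hlsc h hσ x) fun _ _ =>
    eq_of_mem_proxSet h.ne_bot hconv hσ

theorem prox_eq_iff_mem_proxSet (hlsc : LowerSemicontinuous f) (hconv : Convex ℝ (epigraph f))
    (h : IsSubgradient f p u) (hσ : 0 < σ) : prox σ f x = q ↔ q ∈ proxSet σ f x := by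
  have hprox : prox σ f x ∈ proxSet σ f x :=
    Classical.epsilon_spec (proxSet_nonempty hlsc h hσ x)
  exact ⟨fun hq => hq ▸ hprox, eq_of_mem_proxSet h.ne_bot hconv hσ hprox⟩

theorem proxSet_eq_singleton_prox (hlsc : LowerSemicontinuous f) (hconv : Convex ℝ (epigraph f))
    (h : IsSubgradient f p u) (hσ : 0 < σ) : proxSet σ f = fun x => {prox σ f x} := by
  ext x q
  rw [← prox_eq_iff_mem_proxSet hlsc hconv h hσ, Set.mem_singleton_iff, eq_comm]

end FiniteDimensional

end ProximalMapping

section Conjugate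

variable {E : Type*} [NormedAddCommGroup E] [InnerProductSpace ℝ E] {f : E → EReal}
  {x y u : E}

theorem conjugate_le_coe_iff {b : ℝ} :
    conjugate f y ≤ b ↔ ∀ z, ((⟪y, z⟫ - b : ℝ) : EReal) ≤ f z := by
  refine iSup₂_le_iff.trans (forall_congr' fun z => ?_)
  simp only [effDom, Set.mem_ofPred_eq]
  induction f z with
  | bot => simp [EReal.sub_bot, -EReal.coe_sub]
  | top => simp
  | coe a =>
    simp only [EReal.coe_lt_top, forall_const, ← EReal.coe_sub, EReal.coe_le_coe_iff]
    exact sub_le_comm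

theorem coe_inner_sub_le_conjugate {a : ℝ} (ha : f x = a) (y : E) :
    ((⟪y, x⟫ - a : ℝ) : EReal) ≤ conjugate f y := by
  rw [EReal.coe_sub, ← ha]
  exact le_iSup₂ (f := fun u (_ : u ∈ effDom f) => ((⟪y, u⟫ : ℝ) : EReal) - f u) x
    (ha.trans_lt (EReal.coe_lt_top a))

theorem lowerSemicontinuous_conjugate (f : E → EReal) : LowerSemicontinuous (conjugate f) := by
  refine lowerSemicontinuous_biSup fun u _ => Continuous.lowerSemicontinuous ?_
  have hinner : Continuous fun y : E => ((⟪y, u⟫ : ℝ) : EReal) :=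
    continuous_coe_real_ereal.comp (by fun_prop)
  refine continuous_iff_continuousAt.2 fun y => ?_
  exact (EReal.continuousAt_add (.inl (EReal.coe_ne_top _)) (.inl (EReal.coe_ne_bot _))).comp
    (hinner.continuousAt.prodMk continuousAt_const)

theorem convex_epigraph_conjugate (f : E → EReal) : Convex ℝ (epigraph (conjugate f)) := by
  have hepi : epigraph (conjugate f) =
      ⋂ z, {p : E × ℝ | ((⟪p.1, z⟫ - p.2 : ℝ) : EReal) ≤ f z} := by
    ext p
    simp only [epigraph, Set.mem_ofPred_eq, conjugate_le_coe_iff, Set.mem_iInter]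
  rw [hepi]
  refine convex_iInter fun z => ?_
  have hIic : Convex ℝ {c : ℝ | (c : EReal) ≤ f z} :=
    (Set.ordConnected_Iic.preimage_mono EReal.coe_strictMono.monotone).convex
  refine hIic.is_linear_preimage (f := fun p : E × ℝ => ⟪p.1, z⟫ - p.2)
    ⟨fun p q => ?_, fun c p => ?_⟩
  · simp only [Prod.fst_add, Prod.snd_add, inner_add_left]
    ring
  · simp only [Prod.smul_fst, Prod.smul_snd, real_inner_smul_left, smul_eq_mul, mul_sub]

theorem IsSubgradient.conjugate (h : IsSubgradient f x u) :
    IsSubgradient (conjugate f) u x := by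
  obtain ⟨a, ha, hsub⟩ := h
  refine ⟨⟪u, x⟫ - a, le_antisymm (conjugate_le_coe_iff.2 fun z => ?_)
    (coe_inner_sub_le_conjugate ha u), fun z => ?_⟩
  · convert hsub z using 2
    rw [inner_sub_right]
    ring
  · convert coe_inner_sub_le_conjugate ha z using 2
    rw [inner_sub_right, real_inner_comm z x, real_inner_comm u x]
    ring

variable [FiniteDimensional ℝ E] {x₀ u₀ : E}

/- Minty's argument: the resolvent equation `x + u ∈ p + ∂f(p)` is solvable, and monotonicity of
`∂f*` forces `p = x`. -/
theorem isSubgradient_conjugate_iff (hlsc : LowerSemicontinuous f)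
    (hconv : Convex ℝ (epigraph f)) (h₀ : IsSubgradient f x₀ u₀) :
    IsSubgradient (conjugate f) u x ↔ IsSubgradient f x u := by
  refine ⟨fun h => ?_, IsSubgradient.conjugate⟩
  obtain ⟨p, hp⟩ := proxSet_nonempty hlsc h₀ one_pos (x + u)
  rw [mem_proxSet_one_iff_isSubgradient h₀.ne_bot hconv] at hp
  have hmono := h.inner_sub_nonneg hp.conjugate
  have hneg : u - (x + u - p) = -(x - p) := by abel
  rw [hneg, inner_neg_right, neg_nonneg, real_inner_self_nonpos, sub_eq_zero] at hmono
  rwa [← hmono, add_sub_cancel_left] at hp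

theorem mem_proxSet_conjugate_iff {σ : ℝ} (hlsc : LowerSemicontinuous f)
    (hconv : Convex ℝ (epigraph f)) (h₀ : IsSubgradient f x₀ u₀) (hσ : 0 < σ) :
    u ∈ proxSet σ (conjugate f) y ↔ IsSubgradient f (σ⁻¹ • (y - u)) u := by
  rw [mem_proxSet_iff_isSubgradient h₀.conjugate.ne_bot (convex_epigraph_conjugate f) hσ,
    isSubgradient_conjugate_iff hlsc hconv h₀]

theorem prox_conjugate_add_smul {σ : ℝ} (hlsc : LowerSemicontinuous f)
    (hconv : Convex ℝ (epigraph f)) (h : IsSubgradient f x u) (hσ : 0 < σ) :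
    prox σ (conjugate f) (u + σ • x) = u := by
  rw [prox_eq_iff_mem_proxSet (lowerSemicontinuous_conjugate f) (convex_epigraph_conjugate f)
    h.conjugate hσ, mem_proxSet_conjugate_iff hlsc hconv h hσ, add_sub_cancel_left,
    inv_smul_smul₀ hσ.ne']
  exact h

end Conjugate

section Gradient

variable {E : Type*} [NormedAddCommGroup E] [InnerProductSpace ℝ E] {g : E → ℝ} {P : E → E}
  {D : E →L[ℝ] E} {x z : E}

theorem hasFDerivAt_of_forall_add_inner_le (hg : ∀ x y, g x + ⟪P x, y - x⟫ ≤ g y)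
    (hP : ContinuousAt P x) : HasFDerivAt g (innerSL ℝ (P x)) x := by
  rw [hasFDerivAt_iff_isLittleO, Asymptotics.isLittleO_iff]
  intro ε hε
  filter_upwards [hP.eventually (Metric.ball_mem_nhds (P x) hε)] with y hy
  rw [dist_eq_norm] at hy
  have hlow := hg x y
  have hup := hg y x
  rw [← neg_sub y x, inner_neg_right] at hup
  have hgap : ⟪P y - P x, y - x⟫ ≤ ε * ‖y - x‖ :=
    (real_inner_le_norm _ _).trans (by gcongr)
  rw [inner_sub_left] at hgap
  rw [innerSL_apply_apply, Real.norm_of_nonneg (by linarith)]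
  linarith

theorem isSymmetric_of_hasFDerivAt_gradient (hg : ∀ x, HasFDerivAt g (innerSL ℝ (P x)) x)
    (hD : HasFDerivAt P D z) : (D : E →ₗ[ℝ] E).IsSymmetric := by
  have hsecond : HasFDerivAt (fun x => innerSL ℝ (P x)) ((innerSL ℝ).comp D) z :=
    (innerSL ℝ : E →L[ℝ] E →L[ℝ] ℝ).hasFDerivAt.comp z hD
  intro h k
  have hcomm := second_derivative_symmetric hg hsecond h k
  rw [ContinuousLinearMap.comp_apply, ContinuousLinearMap.comp_apply, innerSL_apply_apply,
    innerSL_apply_apply] at hcomm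
  exact hcomm.trans (real_inner_comm _ _)

theorem inner_nonneg_of_hasFDerivAt_of_monotone (hP : ∀ x y, 0 ≤ ⟪P x - P y, x - y⟫)
    (hD : HasFDerivAt P D z) (h : E) : 0 ≤ ⟪D h, h⟫ := by
  have hline : HasDerivAt (fun t : ℝ => P (z + t • h)) (D h) 0 := hD.hasLineDerivAt h
  rw [hasDerivAt_iff_tendsto_slope] at hline
  refine ge_of_tendsto (hline.inner tendsto_const_nhds) (.of_forall fun t => ?_)
  have hmono := hP (z + t • h) z
  rw [add_sub_cancel_left, inner_smul_right] at hmono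
  rw [slope_def_module, zero_smul, add_zero, sub_zero, real_inner_smul_left]
  simpa only [mul_nonneg_iff, inv_nonneg, inv_nonpos] using hmono

end Gradient

section Loewner

variable {E : Type*} [NormedAddCommGroup E] [InnerProductSpace ℝ E]

instance : IsOrderedAddMonoid (E →L[ℝ] E) where
  add_le_add_left a b hab c := by
    simpa only [ContinuousLinearMap.le_def, add_sub_add_right_eq_sub] using hab

instance : PosSMulMono ℝ (E →L[ℝ] E) where
  smul_le_smul_of_nonneg_left c hc S T hST := by
    rw [ContinuousLinearMap.le_def] at hST ⊢
    rw [← smul_sub]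
    exact hST.smul_of_nonneg hc

theorem isClosed_setOf_isPositive : IsClosed {T : E →L[ℝ] E | T.IsPositive} := by
  simp only [ContinuousLinearMap.isPositive_iff, LinearMap.IsSymmetric,
    ContinuousLinearMap.coe_coe, Set.ofPred_and, Set.ofPred_forall]
  refine .inter ?_ ?_
  · exact isClosed_iInter fun x => isClosed_iInter fun y =>
      isClosed_eq (by fun_prop) (by fun_prop)
  · exact isClosed_iInter fun x => isClosed_le (by fun_prop) (by fun_prop)

instance : OrderClosedTopology (E →L[ℝ] E) where
  isClosed_le' := isClosed_setOf_isPositive.preimage (continuous_snd.sub continuous_fst)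

end Loewner

section Resolvent

variable {E : Type*} [NormedAddCommGroup E] [InnerProductSpace ℝ E] {f : E → EReal} {P : E → E}

/-- `P` is the resolvent `(I + ∂f)⁻¹` of the subdifferential of `f`; for a proper lower
semicontinuous convex function this is the single-valued proximal mapping of `f`. -/
def IsResolvent (f : E → EReal) (P : E → E) : Prop :=
  ∀ z, IsSubgradient f (P z) (z - P z)

theorem isResolvent_prox_one [FiniteDimensional ℝ E] {x u : E} (hlsc : LowerSemicontinuous f)
    (hconv : Convex ℝ (epigraph f)) (h : IsSubgradient f x u) : IsResolvent f (prox 1 f) :=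
  fun _ => (mem_proxSet_one_iff_isSubgradient h.ne_bot hconv).1 <|
    (prox_eq_iff_mem_proxSet hlsc hconv h one_pos).1 rfl

namespace IsResolvent

theorem id_sub (hP : IsResolvent f P) : IsResolvent (conjugate f) fun z => z - P z := fun z => by
  simpa only [sub_sub_cancel] using (hP z).conjugate

theorem norm_sub_sq_le_inner (hP : IsResolvent f P) (z z' : E) :
    ‖P z - P z'‖ ^ 2 ≤ ⟪P z - P z', z - z'⟫ := by
  have hmono := (hP z).inner_sub_nonneg (hP z')
  rwa [sub_sub_sub_comm, inner_sub_left, real_inner_self_eq_norm_sq, real_inner_comm,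
    sub_nonneg] at hmono

theorem lipschitzWith (hP : IsResolvent f P) : LipschitzWith 1 P := by
  refine LipschitzWith.of_dist_le_mul fun z z' => ?_
  rw [dist_eq_norm, dist_eq_norm, NNReal.coe_one, one_mul]
  have hle := (hP.norm_sub_sq_le_inner z z').trans (real_inner_le_norm _ _)
  rw [sq] at hle
  rcases (norm_nonneg (P z - P z')).eq_or_lt with hzero | hpos
  · exact hzero ▸ norm_nonneg _
  · exact le_of_mul_le_mul_left hle hpos

/- The potential is the conjugate of `f + ½ ‖·‖²`, written out in terms of `P`. -/
theorem exists_forall_hasFDerivAt (hP : IsResolvent f P) :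
    ∃ g : E → ℝ, ∀ x, HasFDerivAt g (innerSL ℝ (P x)) x := by
  have hcont := hP.lipschitzWith.continuous
  choose a ha hsub using hP
  refine ⟨fun x => ⟪x, P x⟫ - ‖P x‖ ^ 2 / 2 - a x, fun x =>
    hasFDerivAt_of_forall_add_inner_le (fun x y => ?_) hcont.continuousAt⟩
  have hxy := hsub y (P x)
  rw [ha x, EReal.coe_le_coe_iff] at hxy
  have hsq : 0 ≤ ‖P x - P y‖ ^ 2 := sq_nonneg _
  rw [norm_sub_sq_real] at hsq
  simp only [inner_sub_left, inner_sub_right, real_inner_self_eq_norm_sq] at hxy ⊢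
  rw [real_inner_comm x (P x), real_inner_comm y (P x)]
  rw [real_inner_comm (P x) (P y)] at hxy
  linarith

theorem nonneg_of_hasFDerivAt (hP : IsResolvent f P) {D : E →L[ℝ] E} {z : E}
    (hD : HasFDerivAt P D z) : 0 ≤ D := by
  obtain ⟨g, hg⟩ := hP.exists_forall_hasFDerivAt
  rw [ContinuousLinearMap.nonneg_iff_isPositive, ContinuousLinearMap.isPositive_iff]
  exact ⟨isSymmetric_of_hasFDerivAt_gradient hg hD, inner_nonneg_of_hasFDerivAt_of_monotone
    (fun x y => (sq_nonneg _).trans (hP.norm_sub_sq_le_inner x y)) hD⟩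

theorem le_one_of_hasFDerivAt (hP : IsResolvent f P) {D : E →L[ℝ] E} {z : E}
    (hD : HasFDerivAt P D z) : D ≤ 1 :=
  sub_nonneg.1 (hP.id_sub.nonneg_of_hasFDerivAt ((hasFDerivAt_id z).sub hD))

theorem clarkeJacobian_subset_Icc (hP : IsResolvent f P) (z : E) :
    clarkeJacobian P z ⊆ Set.Icc 0 1 := by
  refine convexHull_min ?_ (convex_Icc 0 1)
  rintro V ⟨xs, hdiff, -, hV⟩
  exact isClosed_Icc.mem_of_tendsto hV (.of_forall fun k =>
    ⟨hP.nonneg_of_hasFDerivAt (hdiff k).hasFDerivAt,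
      hP.le_one_of_hasFDerivAt (hdiff k).hasFDerivAt⟩)

end IsResolvent

end Resolvent

section ConvexHull

variable {V : Type*} [NormedAddCommGroup V] [NormedSpace ℝ V] [FiniteDimensional ℝ V] {K : Set V}
  {x : V}

theorem exists_stdSimplex_sum_smul_eq_of_mem_convexHull (hx : x ∈ convexHull ℝ K) :
    ∃ w ∈ stdSimplex ℝ (Fin (Module.finrank ℝ V + 1)), ∃ z : Fin (Module.finrank ℝ V + 1) → V,
      (∀ j, z j ∈ K) ∧ ∑ j, w j • z j = x := by
  obtain ⟨ι, _, z, w, hz, hind, hw, hw_sum, hwz⟩ := eq_pos_convex_span_of_mem_convexHull hx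
  have hcard : Fintype.card ι ≤ Fintype.card (Fin (Module.finrank ℝ V + 1)) := by
    rw [Fintype.card_fin]
    exact hind.card_le_finrank_succ.trans (Nat.succ_le_succ (Submodule.finrank_le _))
  obtain ⟨e⟩ := Function.Embedding.nonempty_of_card_le hcard
  have : Nonempty ι := Finset.univ_nonempty_iff.1 <|
    Finset.nonempty_of_sum_ne_zero (hw_sum ▸ one_ne_zero)
  refine ⟨fun j => ∑ i with e i = j, w i, ⟨fun j => Finset.sum_nonneg fun i _ => (hw i).le, ?_⟩,
    z ∘ Function.invFun e, fun j => hz ⟨_, rfl⟩, ?_⟩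
  · rw [Finset.sum_fiberwise, hw_sum]
  · rw [← hwz, ← Finset.sum_fiberwise Finset.univ e]
    refine Finset.sum_congr rfl fun j _ => ?_
    rw [Finset.sum_smul]
    refine Finset.sum_congr rfl fun i hi => ?_
    rw [← (Finset.mem_filter.1 hi).2, Function.comp_apply, Function.leftInverse_invFun e.injective]

theorem isCompact_convexHull (hK : IsCompact K) : IsCompact (convexHull ℝ K) := by
  let combination (p : (Fin (Module.finrank ℝ V + 1) → ℝ) × (Fin (Module.finrank ℝ V + 1) → V)) :=
    ∑ j, p.1 j • p.2 j
  have hcont : Continuous combination := continuous_finsetSum _ fun j _ => by fun_prop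
  convert ((isCompact_stdSimplex ℝ _).prod (isCompact_univ_pi fun _ => hK)).image hcont
  apply Set.Subset.antisymm
  · intro x hx
    obtain ⟨w, hw, z, hz, rfl⟩ := exists_stdSimplex_sum_smul_eq_of_mem_convexHull hx
    exact ⟨(w, z), ⟨hw, fun j _ => hz j⟩, rfl⟩
  · rintro _ ⟨⟨w, z⟩, ⟨hw, hz⟩, rfl⟩
    exact (convex_convexHull ℝ K).sum_mem (fun j _ => hw.1 j) hw.2
      fun j _ => subset_convexHull ℝ K (hz j (Set.mem_univ j))

end ConvexHull

section GeneralizedJacobian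

open scoped NNReal

variable {E F : Type*} [NormedAddCommGroup E] [InnerProductSpace ℝ E]
  [NormedAddCommGroup F] [InnerProductSpace ℝ F] {S : E → F} {K : ℝ≥0} {x : E}

theorem isClosed_limitingJacobian (S : E → F) (x : E) : IsClosed (limitingJacobian S x) := by
  have hslice : limitingJacobian S x = (fun V => (x, V)) ⁻¹'
      closure ((fun y => (y, fderiv ℝ S y)) '' {y | DifferentiableAt ℝ S y}) := by
    ext V
    simp only [limitingJacobian, Set.mem_ofPred_eq, Set.mem_preimage, mem_closure_iff_seq_limit]
    constructor
    · rintro ⟨xs, hdiff, hxs, hV⟩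
      exact ⟨fun k => (xs k, fderiv ℝ S (xs k)), fun k => ⟨xs k, hdiff k, rfl⟩, hxs.prodMk_nhds hV⟩
    · rintro ⟨ps, hmem, hps⟩
      choose xs hdiff hxs using hmem
      obtain rfl : (fun k => (xs k, fderiv ℝ S (xs k))) = ps := funext hxs
      exact ⟨xs, hdiff, (continuous_fst.tendsto _).comp hps, (continuous_snd.tendsto _).comp hps⟩
  rw [hslice]
  exact isClosed_closure.preimage (by fun_prop)

theorem norm_le_of_mem_limitingJacobian (hS : LipschitzWith K S) {V : E →L[ℝ] F}
    (hV : V ∈ limitingJacobian S x) : ‖V‖ ≤ K := by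
  obtain ⟨xs, -, -, hlim⟩ := hV
  exact le_of_tendsto hlim.norm (.of_forall fun k => norm_fderiv_le_of_lipschitz ℝ hS)

variable [FiniteDimensional ℝ E] [FiniteDimensional ℝ F]

theorem isCompact_clarkeJacobian (hS : LipschitzWith K S) (x : E) :
    IsCompact (clarkeJacobian S x) := by
  refine isCompact_convexHull ((isCompact_closedBall 0 K).of_isClosed_subset
    (isClosed_limitingJacobian S x) fun V hV => ?_)
  exact mem_closedBall_zero_iff.2 (norm_le_of_mem_limitingJacobian hS hV)

theorem eventually_fderiv_mem_of_limitingJacobian_subset (hS : LipschitzWith K S)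
    {O : Set (E →L[ℝ] F)} (hO : IsOpen O) (hsub : limitingJacobian S x ⊆ O) :
    ∀ᶠ z in 𝓝 x, DifferentiableAt ℝ S z → fderiv ℝ S z ∈ O := by
  by_contra hnot
  obtain ⟨zs, hzs, hbad⟩ := exists_seq_forall_of_frequently (not_eventually.1 hnot)
  simp only [Classical.not_imp] at hbad
  obtain ⟨V, -, φ, hφ, hV⟩ := (isCompact_closedBall (0 : E →L[ℝ] F) K).tendsto_subseq
    (x := fun k => fderiv ℝ S (zs k))
    fun k => mem_closedBall_zero_iff.2 (norm_fderiv_le_of_lipschitz ℝ hS)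
  have hVJ : V ∈ limitingJacobian S x :=
    ⟨zs ∘ φ, fun k => (hbad (φ k)).1, hzs.comp hφ.tendsto_atTop, hV⟩
  obtain ⟨k, hk⟩ := (hV.eventually (hO.mem_nhds (hsub hVJ))).exists
  exact (hbad (φ k)).2 hk

end GeneralizedJacobian

section MeanValue

open MeasureTheory
open scoped NNReal

theorem sub_le_of_ae_deriv_le {φ : ℝ → ℝ} {a b c : ℝ} (hab : a ≤ b)
    (hφ : AbsolutelyContinuousOnInterval φ a b) (hc : ∀ᵐ s, s ∈ Set.Icc a b → deriv φ s ≤ c) :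
    φ b - φ a ≤ (b - a) * c := by
  rw [← hφ.integral_deriv_eq_sub, ← smul_eq_mul, ← intervalIntegral.integral_const]
  exact intervalIntegral.integral_mono_ae_restrict hab hφ.intervalIntegrable_deriv
    intervalIntegrable_const ((ae_restrict_iff' measurableSet_Icc).2 hc)

variable {E : Type*} [NormedAddCommGroup E] [NormedSpace ℝ E] {g : E → ℝ} {K : ℝ≥0} {V : Set E}
  {y h : E} {c : ℝ}

theorem sub_le_of_ae_segment_fderiv_le (hg : LipschitzWith K g) (hV : Convex ℝ V) (hy : y ∈ V)
    (hyh : y + h ∈ V) (hc : ∀ᵐ s : ℝ, DifferentiableAt ℝ g (y + s • h) ∧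
      (y + s • h ∈ V → fderiv ℝ g (y + s • h) h ≤ c)) :
    g (y + h) - g y ≤ c := by
  have hline (s : ℝ) : HasDerivAt (fun s : ℝ => y + s • h) h s := by
    simpa only [one_smul] using ((hasDerivAt_id' s).smul_const h).const_add y
  have hlip : LipschitzWith ‖h‖₊ fun s : ℝ => y + s • h :=
    lipschitzWith_of_nnnorm_deriv_le (fun s => (hline s).differentiableAt)
      fun s => by rw [(hline s).deriv]
  have habs : AbsolutelyContinuousOnInterval (fun s : ℝ => g (y + s • h)) 0 1 :=
    (hg.comp hlip).lipschitzOnWith.absolutelyContinuousOnInterval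
  have hderiv : ∀ᵐ s : ℝ, s ∈ Set.Icc 0 1 → deriv (fun s : ℝ => g (y + s • h)) s ≤ c := by
    filter_upwards [hc] with s ⟨hdiff, hle⟩ hs
    exact le_of_eq_of_le (hdiff.hasFDerivAt.comp_hasDerivAt s (hline s)).deriv
      (hle (hV.add_smul_mem hy hyh hs))
  simpa only [one_smul, zero_smul, add_zero, sub_zero, one_mul] using
    sub_le_of_ae_deriv_le zero_le_one habs hderiv

variable [MeasurableSpace E] [BorelSpace E] [FiniteDimensional ℝ E] (μ : Measure E)
  [μ.IsAddHaarMeasure]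

theorem ae_ae_add_smul {p : E → Prop} (hp : ∀ᵐ y ∂μ, p y) (h : E) :
    ∀ᵐ y ∂μ, ∀ᵐ s : ℝ, p (y + s • h) := by
  have hquasi : Measure.QuasiMeasurePreserving (fun q : E × ℝ => q.1 + q.2 • h)
      (μ.prod volume) μ :=
    QuasiMeasurePreserving.prod_of_left (by fun_prop) (.of_forall fun s =>
      (measurePreserving_add_right μ (s • h)).quasiMeasurePreserving)
  exact Measure.ae_ae_of_ae_prod (hquasi.ae hp)

theorem sub_le_of_ae_fderiv_le (hg : LipschitzWith K g) (hV : Convex ℝ V) (hVo : IsOpen V)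
    (hc : ∀ᵐ z ∂μ, z ∈ V → fderiv ℝ g z h ≤ c) (hy : y ∈ V) (hyh : y + h ∈ V) :
    g (y + h) - g y ≤ c := by
  have hdense := Measure.dense_of_ae (ae_ae_add_smul μ (hg.ae_differentiableAt.and hc) h)
  have hopen : IsOpen (V ∩ (· + h) ⁻¹' V) := hVo.inter (hVo.preimage (by fun_prop))
  have hclosed : IsClosed {z | g (z + h) - g z ≤ c} := by
    have hcont := hg.continuous
    exact isClosed_le (by fun_prop) continuous_const
  refine closure_minimal ?_ hclosed (hdense.open_subset_closure_inter hopen ⟨hy, hyh⟩)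
  rintro z ⟨⟨hz, hzh⟩, hae⟩
  exact sub_le_of_ae_segment_fderiv_le hg hV hz hzh hae

end MeanValue

section Normals

open scoped NNReal

section Pullback

variable {H H' : Type*} [NormedAddCommGroup H] [NormedAddCommGroup H'] [InnerProductSpace ℝ H']
  {C : Set H} {D : Set H'} {x : H} {y : H'}

theorem eventually_inner_image_sub_le_of_mem_regularNormalCone {Φ : H → H'} {K : ℝ≥0}
    (hΦ : LipschitzWith K Φ) (hCD : Set.MapsTo Φ C D) (hy : y ∈ regularNormalCone D (Φ x)) {ε : ℝ}
    (hε : 0 < ε) : ∀ᶠ z in 𝓝[C] x, ⟪y, Φ z - Φ x⟫ ≤ ε * ‖z - x‖ := by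
  have htend : Tendsto Φ (𝓝[C] x) (𝓝[D] (Φ x)) :=
    hΦ.continuous.continuousWithinAt.tendsto_nhdsWithin hCD
  filter_upwards [htend.eventually (hy.2 (ε / (K + 1)) (by positivity))] with z hz
  calc ⟪y, Φ z - Φ x⟫ ≤ ε / (K + 1) * ‖Φ z - Φ x‖ := hz
    _ ≤ ε / (K + 1) * (K * ‖z - x‖) := by gcongr; exact hΦ.norm_sub_le z x
    _ ≤ ε / (K + 1) * ((K + 1) * ‖z - x‖) := by gcongr; linarith
    _ = ε * ‖z - x‖ := by field_simp

variable [InnerProductSpace ℝ H] [CompleteSpace H] [CompleteSpace H']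

theorem adjoint_mem_regularNormalCone_preimage (T : H →L[ℝ] H')
    (hy : y ∈ regularNormalCone D (T x)) :
    T.adjoint y ∈ regularNormalCone (T ⁻¹' D) x := by
  refine ⟨hy.1, fun ε hε => ?_⟩
  simpa only [ContinuousLinearMap.adjoint_inner_left, map_sub] using
    eventually_inner_image_sub_le_of_mem_regularNormalCone T.lipschitz (Set.mapsTo_preimage T D)
      hy hε

theorem adjoint_mem_limitingNormalCone_preimage (T : H ≃L[ℝ] H')
    (hy : y ∈ limitingNormalCone D (T x)) :
    (T : H →L[ℝ] H').adjoint y ∈ limitingNormalCone (T ⁻¹' D) x := by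
  obtain ⟨hx, xs, ys, hxs, hxslim, hys, hyslim⟩ := hy
  refine ⟨hx, fun k => T.symm (xs k), fun k => (T : H →L[ℝ] H').adjoint (ys k), fun k => ?_, ?_,
    fun k => adjoint_mem_regularNormalCone_preimage (T : H →L[ℝ] H') ?_,
    (ContinuousLinearMap.continuous _).tendsto y |>.comp hyslim⟩
  · simpa only [Set.mem_preimage, T.apply_symm_apply] using hxs k
  · simpa only [Function.comp_def, T.symm_apply_apply] using
      (T.symm.continuous.tendsto (T x)).comp hxslim
  · simpa only [ContinuousLinearEquiv.coe_coe, T.apply_symm_apply] using hys k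

end Pullback

variable {E F : Type*} [NormedAddCommGroup E] [InnerProductSpace ℝ E] [NormedAddCommGroup F]
  [InnerProductSpace ℝ F] {S : E → F} {K : ℝ≥0} {x h w : E} {e e' : F} {c : ℝ}

theorem eventually_inner_sub_inner_le_of_mem_regularNormalCone_gph (hS : LipschitzWith K S)
    (hw : WithLp.toLp 2 (w, -e) ∈
      regularNormalCone (gph fun z => {S z}) (WithLp.toLp 2 (x, S x))) {ε : ℝ} (hε : 0 < ε) :
    ∀ᶠ z in 𝓝 x, ⟪w, z - x⟫ - ⟪e, S z - S x⟫ ≤ ε * ‖z - x‖ := by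
  have hgraph := (WithLp.prod_lipschitzWith_toLp 2 E F).comp (LipschitzWith.id.prodMk hS)
  have hmaps : Set.MapsTo (fun z => WithLp.toLp 2 (z, S z)) Set.univ (gph fun z => {S z}) :=
    fun z _ => rfl
  simpa [sub_eq_add_neg] using
    eventually_inner_image_sub_le_of_mem_regularNormalCone hgraph hmaps hw hε

theorem inner_le_of_mem_regularNormalCone_gph (hS : LipschitzWith K S)
    (hw : WithLp.toLp 2 (w, -e) ∈
      regularNormalCone (gph fun z => {S z}) (WithLp.toLp 2 (x, S x)))
    (hc : ∀ᶠ t : ℝ in 𝓝[>] 0, ⟪e, S (x + t • h) - S x⟫ ≤ c * t) : ⟪w, h⟫ ≤ c := by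
  refine le_of_forall_pos_le_add_mul (c := ‖h‖) fun ε hε => ?_
  have hnormal := (tendsto_add_smul_nhdsGT_zero x h).eventually
    (eventually_inner_sub_inner_le_of_mem_regularNormalCone_gph hS hw hε)
  obtain ⟨t, ⟨hwt, hct⟩, ht : 0 < t⟩ := ((hnormal.and hc).and self_mem_nhdsWithin).exists
  rw [add_sub_cancel_left, inner_smul_right, norm_smul, Real.norm_of_nonneg ht.le] at hwt
  refine le_of_mul_le_mul_left ?_ ht
  linarith

theorem eventually_inner_add_smul_sub_le_of_lipschitzWith (hS : LipschitzWith K S)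
    (hc : ∀ᶠ t : ℝ in 𝓝[>] 0, ⟪e, S (x + t • h) - S x⟫ ≤ c * t) (e' : F) :
    ∀ᶠ t : ℝ in 𝓝[>] 0, ⟪e', S (x + t • h) - S x⟫ ≤ (c + ‖e' - e‖ * (K * ‖h‖)) * t := by
  filter_upwards [hc, self_mem_nhdsWithin] with t hct (ht : 0 < t)
  have hstep : ‖S (x + t • h) - S x‖ ≤ K * (t * ‖h‖) := by
    simpa only [add_sub_cancel_left, norm_smul, Real.norm_of_nonneg ht.le] using
      hS.norm_sub_le (x + t • h) x
  calc ⟪e', S (x + t • h) - S x⟫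
      = ⟪e, S (x + t • h) - S x⟫ + ⟪e' - e, S (x + t • h) - S x⟫ := by
        rw [inner_sub_left, add_sub_cancel]
    _ ≤ c * t + ‖e' - e‖ * (K * (t * ‖h‖)) :=
        add_le_add hct ((real_inner_le_norm _ _).trans (by gcongr))
    _ = (c + ‖e' - e‖ * (K * ‖h‖)) * t := by ring

theorem exists_seq_of_mem_limitingCoderivative {u : F}
    (hw : w ∈ limitingCoderivative (fun z => {S z}) x u e) :
    ∃ (xs ws : ℕ → E) (es : ℕ → F), Tendsto xs atTop (𝓝 x) ∧ Tendsto ws atTop (𝓝 w) ∧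
      Tendsto es atTop (𝓝 e) ∧ ∀ k, WithLp.toLp 2 (ws k, -es k) ∈
        regularNormalCone (gph fun z => {S z}) (WithLp.toLp 2 (xs k, S (xs k))) := by
  obtain ⟨-, ps, ns, hps, hpslim, hns, hnslim⟩ := hw
  have hcont := WithLp.prod_continuous_ofLp 2 E F
  refine ⟨fun k => (ps k).fst, fun k => (ns k).fst, fun k => -(ns k).snd,
    (hcont.fst.tendsto _).comp hpslim, (hcont.fst.tendsto _).comp hnslim, ?_, fun k => ?_⟩
  · have hsnd : Tendsto (fun k => -(ns k).snd) atTop (𝓝 (- -e)) :=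
      ((hcont.snd.tendsto _).comp hnslim).neg
    rwa [neg_neg] at hsnd
  · have hgraph : (ps k).snd = S (ps k).fst := hps k
    rw [neg_neg, ← hgraph]
    exact hns k

section FiniteDimensional

variable [FiniteDimensional ℝ E] [FiniteDimensional ℝ F]

theorem eventually_inner_add_smul_sub_le_of_limitingJacobian (hS : LipschitzWith K S)
    (hc : ∀ U ∈ limitingJacobian S x, ⟪e, U h⟫ < c) :
    ∀ᶠ y in 𝓝 x, ∀ᶠ t : ℝ in 𝓝[>] 0, ⟪e, S (y + t • h) - S y⟫ ≤ c * t := by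
  borelize E
  have hopen : IsOpen {U : E →L[ℝ] F | ⟪e, U h⟫ < c} := isOpen_lt (by fun_prop) continuous_const
  obtain ⟨δ, hδ, hball⟩ := Metric.eventually_nhds_iff_ball.1
    (eventually_fderiv_mem_of_limitingJacobian_subset hS hopen hc)
  have hg : LipschitzWith (‖innerSL ℝ e‖₊ * K) fun z => ⟪e, S z⟫ :=
    (innerSL ℝ e).lipschitz.comp hS
  filter_upwards [Metric.ball_mem_nhds x hδ] with y hy
  filter_upwards [(tendsto_add_smul_nhdsGT_zero y h).eventually (Metric.isOpen_ball.mem_nhds hy),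
    self_mem_nhdsWithin] with t hyt (ht : 0 < t)
  have hfderiv : ∀ᵐ z ∂(MeasureTheory.Measure.addHaar : MeasureTheory.Measure E),
      z ∈ Metric.ball x δ → fderiv ℝ (fun z => ⟪e, S z⟫) z (t • h) ≤ c * t := by
    filter_upwards [hS.ae_differentiableAt] with z hdiff hz
    have hderiv : HasFDerivAt (fun z => ⟪e, S z⟫) ((innerSL ℝ e).comp (fderiv ℝ S z)) z :=
      (innerSL ℝ e).hasFDerivAt.comp z hdiff.hasFDerivAt
    rw [hderiv.fderiv, map_smul, smul_eq_mul, mul_comm c]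
    exact mul_le_mul_of_nonneg_left (hball z hz hdiff).le ht.le
  rw [inner_sub_right]
  exact sub_le_of_ae_fderiv_le _ hg (convex_ball x δ) Metric.isOpen_ball hfderiv hy hyt

theorem inner_le_of_mem_limitingCoderivative {u : F} (hS : LipschitzWith K S)
    (hw : w ∈ limitingCoderivative (fun z => {S z}) x u e)
    (hc : ∀ U ∈ limitingJacobian S x, ⟪e, U h⟫ < c) : ⟪w, h⟫ ≤ c := by
  obtain ⟨xs, ws, es, hxs, hws, hes, hnormal⟩ := exists_seq_of_mem_limitingCoderivative hw
  have hbound : ∀ᶠ k in atTop, ⟪ws k, h⟫ ≤ c + ‖es k - e‖ * (K * ‖h‖) := by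
    filter_upwards [hxs.eventually (eventually_inner_add_smul_sub_le_of_limitingJacobian hS hc)]
      with k hk
    exact inner_le_of_mem_regularNormalCone_gph hS (hnormal k)
      (eventually_inner_add_smul_sub_le_of_lipschitzWith hS hk (es k))
  refine le_of_tendsto_of_tendsto (hws.inner tendsto_const_nhds) ?_ hbound
  simpa only [sub_self, norm_zero, zero_mul, add_zero] using
    (((hes.sub_const e).norm).mul_const (K * ‖h‖)).const_add c

-- One inclusion of the scalarization formula `conv D*S(x)(e) = {U* e | U ∈ JS(x)}`.
theorem exists_mem_clarkeJacobian_eq_adjoint {u : F} (hS : LipschitzWith K S)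
    (hw : w ∈ limitingCoderivative (fun z => {S z}) x u e) :
    ∃ U ∈ clarkeJacobian S x, U.adjoint e = w := by
  let A : (E →L[ℝ] F) →ₗ[ℝ] E :=
    { toFun := fun U => U.adjoint e
      map_add' := fun U V => by simp
      map_smul' := fun a U => by simp }
  have hconv : Convex ℝ (A '' clarkeJacobian S x) := (convex_convexHull ℝ _).linear_image A
  have hclosed : IsClosed (A '' clarkeJacobian S x) :=
    ((isCompact_clarkeJacobian hS x).image A.continuous_of_finiteDimensional).isClosed
  by_contra hnot
  obtain ⟨f, c, hfc, hcw⟩ := geometric_hahn_banach_closed_point hconv hclosed hnot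
  obtain ⟨h, rfl⟩ := (InnerProductSpace.toDual ℝ E).surjective f
  simp only [InnerProductSpace.toDual_apply_apply] at hfc hcw
  refine hcw.not_ge ?_
  rw [real_inner_comm]
  refine inner_le_of_mem_limitingCoderivative hS hw fun U hU => ?_
  rw [← ContinuousLinearMap.adjoint_inner_left, real_inner_comm]
  exact hfc _ ⟨U, subset_convexHull ℝ _ hU, rfl⟩

end FiniteDimensional

end Normals

section ChangeOfCoordinates

variable {E : Type*} [NormedAddCommGroup E] [InnerProductSpace ℝ E] {f : E → EReal} {σ : ℝ}
  {x u v d : E}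

/-- The linear change of coordinates of the product space that carries the graph of `Prox_f` onto
the graph of `Prox_{σ f*}`: it takes `(x + u, x)` to `(u + σ x, u)`. -/
noncomputable def graphEquiv (hσ : σ ≠ 0) : WithLp 2 (E × E) ≃L[ℝ] WithLp 2 (E × E) where
  toFun p := WithLp.toLp 2 (p.fst + (σ - 1) • p.snd, p.fst - p.snd)
  invFun q := WithLp.toLp 2 (σ⁻¹ • (q.fst - q.snd) + q.snd, σ⁻¹ • (q.fst - q.snd))
  map_add' p q := by
    refine WithLp.ofLp_injective 2 (Prod.ext ?_ ?_) <;>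
      simp only [WithLp.add_fst, WithLp.add_snd, WithLp.ofLp_add, Prod.mk_add_mk] <;> module
  map_smul' a p := by
    refine WithLp.ofLp_injective 2 (Prod.ext ?_ ?_) <;>
      simp only [WithLp.smul_fst, WithLp.smul_snd, Real.ringHom_apply, WithLp.ofLp_smul,
        Prod.smul_mk] <;> module
  left_inv p := by
    have h : p.fst + (σ - 1) • p.snd - (p.fst - p.snd) = σ • p.snd := by module
    refine WithLp.ofLp_injective 2 (Prod.ext ?_ ?_) <;> simp [h, hσ]
  right_inv q := by
    have h : q.fst - q.snd = σ • σ⁻¹ • (q.fst - q.snd) := (smul_inv_smul₀ hσ _).symm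
    refine WithLp.ofLp_injective 2 (Prod.ext ?_ (add_sub_cancel_left _ _))
    change σ⁻¹ • (q.fst - q.snd) + q.snd + (σ - 1) • σ⁻¹ • (q.fst - q.snd) = q.fst
    rw [sub_smul, ← h, one_smul]
    abel
  continuous_toFun := by fun_prop
  continuous_invFun := by fun_prop

theorem graphEquiv_toLp_add (hσ : σ ≠ 0) :
    graphEquiv hσ (WithLp.toLp 2 (x + u, x)) = WithLp.toLp 2 (u + σ • x, u) := by
  refine WithLp.ofLp_injective 2 (Prod.ext ?_ ?_)
  · change x + u + (σ - 1) • x = u + σ • x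
    module
  · exact add_sub_cancel_left x u

theorem adjoint_graphEquiv_toLp_neg [CompleteSpace E] (hσ : σ ≠ 0) :
    (graphEquiv (E := E) hσ : WithLp 2 (E × E) →L[ℝ] WithLp 2 (E × E)).adjoint
      (WithLp.toLp 2 (v, -d)) = WithLp.toLp 2 (v - d, (σ - 1) • v + d) := by
  refine ext_inner_right ℝ fun p => ?_
  rw [ContinuousLinearMap.adjoint_inner_left]
  change ⟪v, p.fst + (σ - 1) • p.snd⟫ + ⟪-d, p.fst - p.snd⟫ =
    ⟪v - d, p.fst⟫ + ⟪(σ - 1) • v + d, p.snd⟫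
  simp only [inner_add_left, inner_add_right, inner_sub_left, inner_sub_right, inner_neg_left,
    real_inner_smul_left, inner_smul_right]
  ring

theorem preimage_graphEquiv_gph_proxSet_conjugate [FiniteDimensional ℝ E]
    (hlsc : LowerSemicontinuous f) (hconv : Convex ℝ (epigraph f)) (h : IsSubgradient f x u)
    (hσ : 0 < σ) :
    graphEquiv hσ.ne' ⁻¹' gph (proxSet σ (conjugate f)) = gph (proxSet 1 f) := by
  ext p
  have hsnd : σ⁻¹ • (p.fst + (σ - 1) • p.snd - (p.fst - p.snd)) = p.snd := by
    rw [show p.fst + (σ - 1) • p.snd - (p.fst - p.snd) = σ • p.snd by module,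
      inv_smul_smul₀ hσ.ne']
  change p.fst - p.snd ∈ proxSet σ (conjugate f) (p.fst + (σ - 1) • p.snd) ↔
    p.snd ∈ proxSet 1 f p.fst
  rw [mem_proxSet_conjugate_iff hlsc hconv h hσ, hsnd,
    mem_proxSet_one_iff_isSubgradient h.ne_bot hconv]

theorem sub_mem_limitingCoderivative_proxSet_one [FiniteDimensional ℝ E]
    (hlsc : LowerSemicontinuous f) (hconv : Convex ℝ (epigraph f)) (h : IsSubgradient f x u)
    (hσ : 0 < σ)
    (hv : v ∈ limitingCoderivative (proxSet σ (conjugate f)) (u + σ • x) u d) :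
    v - d ∈ limitingCoderivative (proxSet 1 f) (x + u) x (-((σ - 1) • v + d)) := by
  rw [limitingCoderivative, Set.mem_ofPred_eq, ← graphEquiv_toLp_add hσ.ne'] at hv
  have hadjoint := adjoint_mem_limitingNormalCone_preimage _ hv
  rwa [adjoint_graphEquiv_toLp_neg, preimage_graphEquiv_gph_proxSet_conjugate hlsc hconv h hσ,
    ← neg_neg ((σ - 1) • v + d)] at hadjoint

end ChangeOfCoordinates

section Inversion

variable {E : Type*} [NormedAddCommGroup E] [InnerProductSpace ℝ E] {U : E →L[ℝ] E} {σ : ℝ}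

theorem min_one_mul_norm_sq_le_inner (hU : U ∈ Set.Icc 0 1) (z : E) :
    min 1 σ * ‖z‖ ^ 2 ≤ ⟪(1 + (σ - 1) • U) z, z⟫ := by
  have hnonneg : 0 ≤ ⟪U z, z⟫ :=
    ((ContinuousLinearMap.nonneg_iff_isPositive U).1 hU.1).inner_nonneg_left z
  have hle : 0 ≤ ⟪(1 - U) z, z⟫ :=
    ((ContinuousLinearMap.le_def U 1).1 hU.2).inner_nonneg_left z
  have hone : ⟪(1 - U) z, z⟫ + ⟪U z, z⟫ = ‖z‖ ^ 2 := by
    rw [← inner_add_left, ← real_inner_self_eq_norm_sq]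
    congr 1
    exact sub_add_cancel z (U z)
  calc min 1 σ * ‖z‖ ^ 2 = min 1 σ * ⟪(1 - U) z, z⟫ + min 1 σ * ⟪U z, z⟫ := by rw [← hone, mul_add]
    _ ≤ 1 * ⟪(1 - U) z, z⟫ + σ * ⟪U z, z⟫ := by
      gcongr
      exacts [min_le_left 1 σ, min_le_right 1 σ]
    _ = ⟪(1 + (σ - 1) • U) z, z⟫ := by
      rw [one_mul, ← real_inner_smul_left, ← inner_add_left]
      congr 1
      change z - U z + σ • U z = z + (σ - 1) • U z
      module

theorem isUnit_one_add_sub_one_smul [CompleteSpace E] (hU : U ∈ Set.Icc 0 1) (hσ : 0 < σ) :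
    IsUnit (1 + (σ - 1) • U) := by
  have hpos : 0 < min 1 σ := lt_min one_pos hσ
  refine ContinuousLinearMap.isUnit_of_forall_le_norm_inner_map (c := ⟨min 1 σ, hpos.le⟩) _ hpos
    fun z => ?_
  rw [mul_comm]
  exact (min_one_mul_norm_sq_le_inner hU z).trans (le_abs_self _)

theorem eq_inverse_apply_of_adjoint_eq_sub [CompleteSpace E] {v d : E} (hU : IsSelfAdjoint U)
    (hunit : IsUnit (1 + (σ - 1) • U)) (h : U.adjoint (-((σ - 1) • v + d)) = v - d) :
    v = Ring.inverse (1 + (σ - 1) • U) ((1 - U) d) := by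
  rw [hU.adjoint_eq, map_neg, map_add, map_smul] at h
  have heq : (1 + (σ - 1) • U) v = (1 - U) d := by
    change v + (σ - 1) • U v = d - U d
    calc v + (σ - 1) • U v = (v - d) + d + (σ - 1) • U v := by abel
      _ = d - U d := by rw [← h]; abel
  rw [← heq, ← mul_apply_eq_comp, Ring.inverse_mul_cancel _ hunit]
  rfl

end Inversion

end ProxCoderivative

open ProxCoderivative in
theorem mainTheorem3_general {E : Type*} [NormedAddCommGroup E] [InnerProductSpace ℝ E]
    [FiniteDimensional ℝ E] {r : E → EReal} (hbot : ∀ x, r x ≠ ⊥) (hlsc : LowerSemicontinuous r)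
    (hconv : Convex ℝ (epigraph r)) {x u : E} (hu : u ∈ limitingSubdifferential r x) {σ : ℝ}
    (hσ : 0 < σ) :
    (∀ z, ∃! p, p ∈ proxSet 1 r z) ∧ (∀ z, ∃! p, p ∈ proxSet σ (conjugate r) z) ∧
    ∀ d : E, ∀ v ∈ limitingCoderivative (proxSet σ (conjugate r)) (u + σ • x)
        (prox σ (conjugate r) (u + σ • x)) d,
      ∃ U ∈ clarkeJacobian (prox 1 r) (x + u),
        IsUnit (1 + (σ - 1) • U) ∧ v = Ring.inverse (1 + (σ - 1) • U) ((1 - U) d) := by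
  have hsub := IsSubgradient.of_mem_limitingSubdifferential hbot hconv hu
  have hP := isResolvent_prox_one hlsc hconv hsub
  refine ⟨existsUnique_mem_proxSet hlsc hconv hsub one_pos,
    existsUnique_mem_proxSet (lowerSemicontinuous_conjugate r) (convex_epigraph_conjugate r)
      hsub.conjugate hσ, fun d v hv => ?_⟩
  rw [prox_conjugate_add_smul hlsc hconv hsub hσ] at hv
  have hv' := sub_mem_limitingCoderivative_proxSet_one hlsc hconv hsub hσ hv
  rw [proxSet_eq_singleton_prox hlsc hconv hsub one_pos] at hv'
  obtain ⟨U, hU, hUv⟩ := exists_mem_clarkeJacobian_eq_adjoint hP.lipschitzWith hv'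
  have hIcc := hP.clarkeJacobian_subset_Icc (x + u) hU
  have hunit := isUnit_one_add_sub_one_smul hIcc hσ
  have hadjoint := ((ContinuousLinearMap.nonneg_iff_isPositive U).1 hIcc.1).isSelfAdjoint
  exact ⟨U, hU, hunit, eq_inverse_apply_of_adjoint_eq_sub hadjoint hunit hUv⟩

theorem mainTheorem3 (m : ℕ) (r : EuclideanSpace ℝ (Fin m) → EReal)
    (hbot : ∀ x, r x ≠ ⊥)
    (hlsc : LowerSemicontinuous r)
    (hconv : Convex ℝ (ProxCoderivative.epigraph r))
    (xbar ubar : EuclideanSpace ℝ (Fin m))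
    (hx : xbar ∈ ProxCoderivative.effDom r)
    (hu : ubar ∈ ProxCoderivative.limitingSubdifferential r xbar)
    (σ : ℝ) (hσ : 0 < σ) :
    (∀ x, ∃! p, p ∈ ProxCoderivative.proxSet 1 r x) ∧
    (∀ x, ∃! p, p ∈ ProxCoderivative.proxSet σ (ProxCoderivative.conjugate r) x) ∧
    ∀ d : EuclideanSpace ℝ (Fin m),
      ∀ v ∈ ProxCoderivative.limitingCoderivative
        (ProxCoderivative.proxSet σ (ProxCoderivative.conjugate r)) (ubar + σ • xbar)
        (ProxCoderivative.prox σ (ProxCoderivative.conjugate r) (ubar + σ • xbar)) d,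
      ∃ U ∈ ProxCoderivative.clarkeJacobian (ProxCoderivative.prox 1 r) (xbar + ubar),
        IsUnit (1 + (σ - 1) • U) ∧
        v = Ring.inverse (1 + (σ - 1) • U) ((1 - U) d) :=
  mainTheorem3_general hbot hlsc hconv hu hσ
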